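/- All systems are finite-dimensional. For a state (density operator) $\rho$ let $S(\rho)=-\mathrm{tr}[\rho\log\rho]$ be the von Neumann entropy ($\log$ is the natural logarithm; another base rescales every quantity below by the same factor), let $I(X;Y)_\rho=S(X)_\rho+S(Y)_\rho-S(XY)_\rho$ be the mutual information and $I(A;C|B)_\rho=I(A;BC)_\rho-I(A;B)_\rho$ the quantum conditional mutual information, evaluated on the corresponding marginals. For a state $\rho_{ABCD}$ define the hysteretic squashed entanglement $$T_{\mathrm{sq}}(A;C|B)_\rho=\tfrac12\inf\{I(A;C|BE)_\sigma:\ \sigma_{ABCDE}\text{ a state with }\mathrm{tr}_E\,\sigma_{ABCDE}=\rho_{ABCD}\},$$ where $E$ ranges over all finite-dimensional systems, and $$\mathrm{co(QCMI)}[\rho_{ABCD}]=\tfrac12\inf\Big\{\sum_i p_i\,I(A;C|B)_{\psi^i}:\ \rho_{ABCD}=\sum_i p_i\psi^i_{ABCD}\Big\},$$ where the infimum is over all finite ensembles $\{p_i,\psi^i_{ABCD}\}_i$ of pure states with average $\rho_{ABCD}$. Theorem. Let $\rho_{ABCD}$ be an arbitrary state. Both infima are infima of non-empty sets of real numbers that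 are bounded below, and $$0\le T_{\mathrm{sq}}(A;C|B)_\rho\le\mathrm{co(QCMI)}[\rho_{ABCD}].$$ Moreover, for every finite ensemble $\{p_i,\psi^i_{ABCD}\}_i$ of pure states with average $\rho_{ABCD}$, the operator $\sigma_{ABCDE}=\sum_i p_i\,\psi^i_{ABCD}\otimes|i\rangle\langle i|_E$, where $\{|i\rangle\}_i$ is an orthonormal basis of $E$, is a state with $\mathrm{tr}_E\,\sigma_{ABCDE}=\rho_{ABCD}$ and $$I(A;C|BE)_\sigma=\sum_i p_i\,I(A;C|B)_{\psi^i}.$$ If $\rho_{ABCD}$ is pure, then $$T_{\mathrm{sq}}(A;C|B)_\rho=\mathrm{co(QCMI)}[\rho_{ABCD}]=\tfrac12 I(A;C|B)_\rho.$$ -/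

import Mathlib

open scoped ComplexOrder Kronecker

/-- A density operator on the finite-dimensional Hilbert space `ℂ^X`: a positive semidefinite
matrix of trace one. -/
@[ext]
structure QState (X : Type*) [Fintype X] where
  matrix : Matrix X X ℂ
  posSemidef : matrix.PosSemidef
  trace_one : matrix.trace = 1

namespace QState

/-- Relabelling of the basis along a bijection; used only to permute and regroup the tensor
factors of a composite system. -/
def reindex {X Y : Type*} [Fintype X] [Fintype Y] (e : X ≃ Y) (ρ : QState X) : QState Y where
  matrix := ρ.matrix.submatrix e.symm e.symm
  posSemidef := ρ.posSemidef.submatrix e.symm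
  trace_one := by
    rw [← ρ.trace_one]
    simp only [Matrix.trace, Matrix.diag_apply, Matrix.submatrix_apply]
    exact Equiv.sum_comp e.symm fun x => ρ.matrix x x

/-- The marginal `tr_Y ρ` on the first factor of a state `ρ` of a bipartite system `XY`. -/
def traceRight {X Y : Type*} [Fintype X] [Fintype Y] (ρ : QState (X × Y)) : QState X where
  matrix := Matrix.of fun x x' => ∑ y, ρ.matrix (x, y) (x', y)
  posSemidef := by
    have h : (Matrix.of fun x x' => ∑ y, ρ.matrix (x, y) (x', y)) =
        ∑ y : Y, ρ.matrix.submatrix (fun x : X => (x, y)) (fun x : X => (x, y)) := by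
      ext x x'
      simp [Matrix.sum_apply]
    rw [h]
    exact Matrix.posSemidef_sum _ fun y _ => ρ.posSemidef.submatrix _
  trace_one := by
    rw [← ρ.trace_one]
    simp [Matrix.trace, Fintype.sum_prod_type]

/-- The marginal `tr_X ρ` on the second factor of a state `ρ` of a bipartite system `XY`. -/
def traceLeft {X Y : Type*} [Fintype X] [Fintype Y] (ρ : QState (X × Y)) : QState Y :=
  (ρ.reindex (Equiv.prodComm X Y)).traceRight

/-- `ρ` is pure: `ρ = |v⟩⟨v|` (the vector `v` is a unit vector because `ρ` has trace one). -/
def IsPure {X : Type*} [Fintype X] (ρ : QState X) : Prop :=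
  ∃ v : X → ℂ, ρ.matrix = Matrix.vecMulVec v (star v)

/-- The von Neumann entropy `S(ρ) = -tr[ρ log ρ] = -∑ λ log λ`, the sum running over the
eigenvalues `λ` of `ρ` with multiplicity, where `0 log 0 = 0`; `log` is the natural logarithm. -/
noncomputable def entropy {X : Type*} [Fintype X] [DecidableEq X] (ρ : QState X) : ℝ :=
  ∑ i, Real.negMulLog (ρ.posSemidef.isHermitian.eigenvalues i)

/-- The quantum mutual information `I(X;Y) = S(X) + S(Y) - S(XY)`. -/
noncomputable def mutualInfo {X Y : Type*} [Fintype X] [DecidableEq X] [Fintype Y] [DecidableEq Y]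
    (ρ : QState (X × Y)) : ℝ :=
  ρ.traceRight.entropy + ρ.traceLeft.entropy - ρ.entropy

section Tripartite

variable {A B C : Type*} [Fintype A] [DecidableEq A] [Fintype B] [DecidableEq B]
  [Fintype C] [DecidableEq C]

/-- The marginal on `AB` of a state of `ABC`. -/
def marginalAB (ρ : QState (A × B × C)) : QState (A × B) :=
  (ρ.reindex (Equiv.prodAssoc A B C).symm).traceRight

/-- The quantum conditional mutual information `I(A;C|B) = I(A;BC) - I(A;B)` of a state
of `ABC`. -/
noncomputable def qcmi (ρ : QState (A × B × C)) : ℝ :=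
  ρ.mutualInfo - ρ.marginalAB.mutualInfo

end Tripartite

section Quadripartite

variable {A B C D : Type*} [Fintype A] [DecidableEq A] [Fintype B] [DecidableEq B]
  [Fintype C] [DecidableEq C] [Fintype D]

/-- The marginal on `ABC` of a state of `ABCD`. -/
def marginalABC (ρ : QState (A × B × C × D)) : QState (A × B × C) :=
  (ρ.reindex
    { toFun := fun (a, b, c, d) => ((a, b, c), d)
      invFun := fun ((a, b, c), d) => (a, b, c, d)
      left_inv := fun _ => rfl
      right_inv := fun _ => rfl }).traceRight

/-- The marginal on `A(BE)C` of a state of `(ABCD)E`, with `BE` grouped into one system. -/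
def marginalABEC {E : Type*} [Fintype E] (σ : QState ((A × B × C × D) × E)) :
    QState (A × (B × E) × C) :=
  (σ.reindex
    { toFun := fun ((a, b, c, d), e) => ((a, (b, e), c), d)
      invFun := fun ((a, (b, e), c), d) => ((a, b, c, d), e)
      left_inv := fun _ => rfl
      right_inv := fun _ => rfl }).traceRight

/-- The values `I(A;C|BE)_σ`, where `σ` runs over all state extensions of `ρ` to `ABCDE` and `E`
over all finite-dimensional systems. -/
def extensionValues (ρ : QState (A × B × C × D)) : Set ℝ :=
  {x | ∃ (n : ℕ) (σ : QState ((A × B × C × D) × Fin n)),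
    σ.traceRight = ρ ∧ x = σ.marginalABEC.qcmi}

/-- The hysteretic squashed entanglement `T_sq(A;C|B)_ρ`. -/
noncomputable def hystereticSquashed (ρ : QState (A × B × C × D)) : ℝ :=
  (1 / 2) * sInf ρ.extensionValues

end Quadripartite

/-- A (finite) ensemble of pure states `{p i, ψ i}` with average state `ρ`. -/
structure PureEnsemble {X : Type*} [Fintype X] (ρ : QState X) where
  size : ℕ
  p : Fin size → ℝ
  ψ : Fin size → QState X
  p_nonneg : ∀ i, 0 ≤ p i
  p_sum : ∑ i, p i = 1
  ψ_pure : ∀ i, (ψ i).IsPure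
  average : ∑ i, (p i : ℂ) • (ψ i).matrix = ρ.matrix

/-- The matrix `∑ i, p i • ψ i ⊗ |i⟩⟨i|` on `XE`, where `E` has the orthonormal basis `|i⟩`. -/
def PureEnsemble.flagMatrix {X : Type*} [Fintype X] {ρ : QState X} (e : PureEnsemble ρ) :
    Matrix (X × Fin e.size) (X × Fin e.size) ℂ :=
  ∑ i, (e.p i : ℂ) • ((e.ψ i).matrix ⊗ₖ Matrix.single i i (1 : ℂ))

section ConvexRoof

variable {A B C D : Type*} [Fintype A] [DecidableEq A] [Fintype B] [DecidableEq B]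
  [Fintype C] [DecidableEq C] [Fintype D]

/-- The average `∑ i, p i * I(A;C|B)_{ψ i}` over a pure-state ensemble of a state of `ABCD`. -/
noncomputable def PureEnsemble.averageQCMI {ρ : QState (A × B × C × D)}
    (e : PureEnsemble ρ) : ℝ :=
  ∑ i, e.p i * (e.ψ i).marginalABC.qcmi

/-- The values of `∑ i, p i * I(A;C|B)_{ψ i}` over all pure-state ensembles of `ρ`. -/
def ensembleValues (ρ : QState (A × B × C × D)) : Set ℝ :=
  Set.range fun e : PureEnsemble ρ => e.averageQCMI

/-- The convex-roof extension of the quantum conditional mutual information, `co(QCMI)[ρ]`. -/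
noncomputable def coQCMI (ρ : QState (A × B × C × D)) : ℝ :=
  (1 / 2) * sInf ρ.ensembleValues

end ConvexRoof

end QState

/-! Two facts about the value sets carry the theorem: every value $I(A;C|BE)$ is nonnegative
(`qcmi_nonneg`), and every ensemble average is such a value, realised by a classical flag on $E$
(`ensembleValues_subset_extensionValues`). Nonnegativity, bounds and the inequality of infima
follow.

Nonnegativity is strong subadditivity: $D(\rho_{ABC}\|1\otimes\rho_{BC})=S(BC)-S(ABC)$ does not
increase when $C$ is traced out. Monotonicity of $D$ comes from differentiating
$\mathrm{tr}\,\rho\log$ along an interpolation from $\rho$ to $\sigma$. The derivative contains a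
quadratic quantity that is a maximum over test matrices $X$, and a test matrix for the reduced
states lifts to $X\otimes 1_C$.

Flags are handled by $S(\sum_i p_i\rho_i\otimes|i\rangle\langle i|)=H(p)+\sum_i p_iS(\rho_i)$: in
the conditional mutual information the four copies of $H(p)$ cancel. An extension of a pure state is
a product state; diagonalised on $E$, it is a flagged ensemble with constant member, so the same
formula leaves a single possible value. -/

namespace Matrix

/-! ### Monotonicity of relative entropy, in spectral form -/

theorem continuousOn_sum_mul_log_interpolate {n : Type*} [Fintype n] (P : n → n → ℝ) (a b : n → ℝ)
    (ha : ∀ i, 0 ≤ a i) (hb : ∀ i, 0 ≤ b i) (hab : ∀ i j, b j = 0 → P i j * a i = 0) :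
    ContinuousOn (fun s : ℝ => ∑ i, ∑ j, P i j * a i * Real.log (s * b j + (1 - s) * a i))
      (Set.Icc 0 1) := by
  refine continuousOn_finsetSum _ fun i _ => continuousOn_finsetSum _ fun j _ => ?_
  by_cases h : P i j * a i = 0
  · simpa [h] using continuousOn_const
  · refine continuousOn_const.mul (ContinuousOn.log (by fun_prop) fun s hs => ?_)
    -- Where the weight is nonzero, both $a_i$ and $b_j$ are positive, so the logarithm stays
    -- regular up to both endpoints; this is the support condition on relative entropy.
    have h1 : 0 < a i := (ha i).lt_of_ne fun h' => h (by simp [← h'])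
    have h2 : 0 < b j := (hb j).lt_of_ne fun h' => h (hab i j h'.symm)
    rcases hs.1.eq_or_lt with h0 | h0
    · simp [← h0, h1.ne']
    · have := mul_pos h0 h2
      have := mul_nonneg (sub_nonneg.mpr hs.2) h1.le
      linarith

/-- With $d=sb+(1-s)a$ one has $s(b-a)=d-a$, so $a(b-a)/d=(a-a^2/d)/s$. The derivative is thus the
total mass minus the quadratic quantity $\sum Pa^2/d$, which has a variational formula. -/
theorem hasDerivAt_sum_mul_log_interpolate {n : Type*} [Fintype n] (P : n → n → ℝ) (a b : n → ℝ)
    (ha : ∀ i, 0 ≤ a i) (hb : ∀ i, 0 ≤ b i) {s : ℝ} (hs : s ∈ Set.Ioo (0 : ℝ) 1) :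
    HasDerivAt (fun s : ℝ => ∑ i, ∑ j, P i j * a i * Real.log (s * b j + (1 - s) * a i))
      ((∑ i, ∑ j, P i j * a i - ∑ i, ∑ j, P i j * a i ^ 2 / (s * b j + (1 - s) * a i)) / s)
      s := by
  rw [← Finset.sum_sub_distrib, Finset.sum_div]
  simp only [← Finset.sum_sub_distrib, Finset.sum_div]
  refine HasDerivAt.fun_sum fun i _ => HasDerivAt.fun_sum fun j _ => ?_
  rcases (ha i).eq_or_lt with h | h
  · simpa [← h] using hasDerivAt_const s (0 : ℝ)
  · have h1 : 0 < s * b j + (1 - s) * a i := by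
      have := mul_nonneg hs.1.le (hb j)
      have := mul_pos (sub_pos.mpr hs.2) h
      linarith
    have h2 : HasDerivAt (fun s : ℝ => s * b j + (1 - s) * a i) (b j - a i) s := by
      have := ((hasDerivAt_id s).mul_const (b j)).add
        (((hasDerivAt_id s).const_sub 1).mul_const (a i))
      rwa [show 1 * b j + -1 * a i = b j - a i by ring] at this
    refine ((h2.log h1.ne').const_mul (P i j * a i)).congr_deriv ?_
    have hs' := hs.1.ne'
    obtain ⟨d, hd⟩ : ∃ d, s * b j + (1 - s) * a i = d := ⟨_, rfl⟩
    rw [hd] at h1 ⊢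
    have hd' := h1.ne'
    field_simp
    rw [← hd]
    ring

variable {n : Type*} [Fintype n] [DecidableEq n]

/-- In the eigenbases $U$ of $\rho$ and $V$ of $\sigma$ the functional of $X$ decouples into one
scalar problem for each entry of $Z=V^*XU$. -/
theorem re_trace_mul_functional_eq {U V ρ σ : Matrix n n ℂ} {p q : n → ℝ}
    (hU : U * Uᴴ = 1) (hV : V * Vᴴ = 1)
    (hρ : ρ = U * diagonal (fun i => (p i : ℂ)) * Uᴴ)
    (hσ : σ = V * diagonal (fun i => (q i : ℂ)) * Vᴴ) (s : ℝ) (X : Matrix n n ℂ) :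
    2 * (ρ * X).trace.re - s * (σ * (X * Xᴴ)).trace.re - (1 - s) * (ρ * (Xᴴ * X)).trace.re =
      ∑ i, ∑ j, (2 * p i * ((Uᴴ * V) i j * (Vᴴ * X * U) j i).re -
        (s * q j + (1 - s) * p i) * Complex.normSq ((Vᴴ * X * U) j i)) := by
  set Z := Vᴴ * X * U with hZ
  have hXZ : X = V * Z * Uᴴ := by
    simp only [hZ, ← Matrix.mul_assoc, hV, Matrix.one_mul]
    rw [Matrix.mul_assoc, hU, Matrix.mul_one]
  have hU' : Uᴴ * U = 1 := mul_eq_one_comm.mp hU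
  have hV' : Vᴴ * V = 1 := mul_eq_one_comm.mp hV
  have e1 : (ρ * X).trace = ∑ i, ∑ j, (p i : ℂ) * ((Uᴴ * V) i j * Z j i) := by
    have : (ρ * X).trace = (diagonal (fun i => (p i : ℂ)) * ((Uᴴ * V) * Z)).trace := by
      rw [hρ, hXZ, show U * diagonal (fun i => (p i : ℂ)) * Uᴴ * (V * Z * Uᴴ) =
        U * (diagonal (fun i => (p i : ℂ)) * Uᴴ * V * Z * Uᴴ) by simp only [Matrix.mul_assoc],
        Matrix.trace_mul_comm]
      simp only [Matrix.mul_assoc, hU', Matrix.mul_one]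
    rw [this]
    simp only [Matrix.trace, Matrix.diag_apply, Matrix.diagonal_mul,
      Matrix.mul_apply (M := Uᴴ * V), Finset.mul_sum]
  have e2 : (σ * (X * Xᴴ)).trace = ∑ i, ∑ j, ((q j * Complex.normSq (Z j i) : ℝ) : ℂ) := by
    have : (σ * (X * Xᴴ)).trace = (diagonal (fun i => (q i : ℂ)) * (Z * Zᴴ)).trace := by
      rw [hσ, hXZ, Matrix.conjTranspose_mul, Matrix.conjTranspose_mul,
        Matrix.conjTranspose_conjTranspose,
        show V * diagonal (fun i => (q i : ℂ)) * Vᴴ * (V * Z * Uᴴ * (U * (Zᴴ * Vᴴ))) =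
        V * (diagonal (fun i => (q i : ℂ)) * (Vᴴ * V) * Z * (Uᴴ * U) * Zᴴ * Vᴴ) by
          simp only [Matrix.mul_assoc],
        Matrix.trace_mul_comm]
      simp only [Matrix.mul_assoc, hU', hV', Matrix.mul_one]
    rw [this, Finset.sum_comm]
    simp only [Matrix.trace, Matrix.diag_apply, Matrix.diagonal_mul]
    simp [Matrix.mul_apply, Finset.mul_sum, Complex.mul_conj]
  have e3 : (ρ * (Xᴴ * X)).trace = ∑ i, ∑ j, ((p i * Complex.normSq (Z j i) : ℝ) : ℂ) := by
    have : (ρ * (Xᴴ * X)).trace = (diagonal (fun i => (p i : ℂ)) * (Zᴴ * Z)).trace := by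
      rw [hρ, hXZ, Matrix.conjTranspose_mul, Matrix.conjTranspose_mul,
        Matrix.conjTranspose_conjTranspose,
        show U * diagonal (fun i => (p i : ℂ)) * Uᴴ * (U * (Zᴴ * Vᴴ) * (V * Z * Uᴴ)) =
        U * (diagonal (fun i => (p i : ℂ)) * (Uᴴ * U) * Zᴴ * (Vᴴ * V) * Z * Uᴴ) by
          simp only [Matrix.mul_assoc],
        Matrix.trace_mul_comm]
      simp only [Matrix.mul_assoc, hU', hV', Matrix.mul_one]
    rw [this]
    simp only [Matrix.trace, Matrix.diag_apply, Matrix.diagonal_mul]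
    simp [Matrix.mul_apply, Finset.mul_sum, Complex.normSq_eq_conj_mul_self]
  rw [e1, e2, e3]
  simp only [Complex.re_sum, Complex.re_ofReal_mul, Complex.ofReal_re, Finset.mul_sum,
    ← Finset.sum_sub_distrib]
  refine Finset.sum_congr rfl fun i _ => Finset.sum_congr rfl fun j _ => ?_
  ring

/-- Completing the square: $|wz-p\bar g|^2\ge 0$. For $w=0$ both sides are $0$, division by zero
included. -/
theorem two_mul_re_mul_sub_le {p w : ℝ} (hw : 0 ≤ w) (hpw : w = 0 → p = 0) (g z : ℂ) :
    2 * p * (g * z).re - w * Complex.normSq z ≤ Complex.normSq g * p ^ 2 / w := by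
  rcases hw.eq_or_lt with h | h
  · simp [← h, hpw h.symm]
  · rw [le_div_iff₀ h]
    simp only [Complex.normSq_apply, Complex.mul_re]
    nlinarith [sq_nonneg (p * g.re - w * z.re), sq_nonneg (p * g.im + w * z.im)]

theorem re_trace_mul_functional_le {U V ρ σ : Matrix n n ℂ} {p q : n → ℝ}
    (hU : U * Uᴴ = 1) (hV : V * Vᴴ = 1)
    (hρ : ρ = U * diagonal (fun i => (p i : ℂ)) * Uᴴ)
    (hσ : σ = V * diagonal (fun i => (q i : ℂ)) * Vᴴ) (hp : ∀ i, 0 ≤ p i) (hq : ∀ i, 0 ≤ q i)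
    {s : ℝ} (hs : 0 < s) (hs1 : s < 1) (X : Matrix n n ℂ) :
    2 * (ρ * X).trace.re - s * (σ * (X * Xᴴ)).trace.re - (1 - s) * (ρ * (Xᴴ * X)).trace.re ≤
      ∑ i, ∑ j, Complex.normSq ((Uᴴ * V) i j) * p i ^ 2 / (s * q j + (1 - s) * p i) := by
  rw [re_trace_mul_functional_eq hU hV hρ hσ]
  refine Finset.sum_le_sum fun i _ => Finset.sum_le_sum fun j _ => ?_
  have h1 : 0 ≤ s * q j := mul_nonneg hs.le (hq j)
  have h2 : 0 ≤ (1 - s) * p i := mul_nonneg (by linarith) (hp i)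
  refine two_mul_re_mul_sub_le (by linarith) (fun h => ?_) _ _
  have h3 : (1 - s) * p i = 0 := by linarith
  exact (mul_eq_zero.mp h3).resolve_left (by linarith)

theorem exists_re_trace_mul_functional_eq {U V ρ σ : Matrix n n ℂ} {p q : n → ℝ}
    (hU : U * Uᴴ = 1) (hV : V * Vᴴ = 1)
    (hρ : ρ = U * diagonal (fun i => (p i : ℂ)) * Uᴴ)
    (hσ : σ = V * diagonal (fun i => (q i : ℂ)) * Vᴴ) (s : ℝ) :
    ∃ X : Matrix n n ℂ,
    2 * (ρ * X).trace.re - s * (σ * (X * Xᴴ)).trace.re - (1 - s) * (ρ * (Xᴴ * X)).trace.re =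
      ∑ i, ∑ j, Complex.normSq ((Uᴴ * V) i j) * p i ^ 2 / (s * q j + (1 - s) * p i) := by
  have hU' : Uᴴ * U = 1 := mul_eq_one_comm.mp hU
  have hV' : Vᴴ * V = 1 := mul_eq_one_comm.mp hV
  set G := Uᴴ * V with hG
  -- The maximiser of each scalar problem, $z=p\bar g/w$; where $w=0$ it is $0$ by convention, as is
  -- the value to be attained.
  let Z : Matrix n n ℂ := Matrix.of fun j i =>
    ((p i / (s * q j + (1 - s) * p i) : ℝ) : ℂ) * star (G i j)
  refine ⟨V * Z * Uᴴ, ?_⟩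
  rw [re_trace_mul_functional_eq hU hV hρ hσ]
  have hZ : Vᴴ * (V * Z * Uᴴ) * U = Z := by
    rw [show Vᴴ * (V * Z * Uᴴ) * U = (Vᴴ * V) * Z * (Uᴴ * U) by simp only [Matrix.mul_assoc],
      hU', hV', Matrix.one_mul, Matrix.mul_one]
  rw [hZ]
  refine Finset.sum_congr rfl fun i _ => Finset.sum_congr rfl fun j _ => ?_
  rw [← hG]
  simp only [Z, Matrix.of_apply]
  rw [mul_left_comm, Complex.star_def, Complex.mul_conj, Complex.normSq_mul, Complex.normSq_conj,
    Complex.normSq_ofReal, ← Complex.ofReal_mul, Complex.ofReal_re]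
  rcases eq_or_ne (s * q j + (1 - s) * p i) 0 with h | h
  · simp [h]
  · field_simp
    ring

/-- Relative entropy of two matrices, computed from spectral decompositions, decreases under
maps whose dual is realised by `Y`. -/
theorem sum_normSq_mul_log_sub_log_le {m : Type*} [Fintype m] [DecidableEq m]
    {U V ρ σ : Matrix n n ℂ} {p q : n → ℝ}
    (hU : U * Uᴴ = 1) (hV : V * Vᴴ = 1)
    (hρ : ρ = U * diagonal (fun i => (p i : ℂ)) * Uᴴ)
    (hσ : σ = V * diagonal (fun i => (q i : ℂ)) * Vᴴ) (hp : ∀ i, 0 ≤ p i) (hq : ∀ i, 0 ≤ q i)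
    (hpq : ∀ i j, q j = 0 → Complex.normSq ((Uᴴ * V) i j) * p i = 0)
    {U' V' ρ' σ' : Matrix m m ℂ} {p' q' : m → ℝ}
    (hU' : U' * U'ᴴ = 1) (hV' : V' * V'ᴴ = 1)
    (hρ' : ρ' = U' * diagonal (fun i => (p' i : ℂ)) * U'ᴴ)
    (hσ' : σ' = V' * diagonal (fun i => (q' i : ℂ)) * V'ᴴ)
    (hp' : ∀ i, 0 ≤ p' i) (hq' : ∀ i, 0 ≤ q' i)
    (hpq' : ∀ i j, q' j = 0 → Complex.normSq ((U'ᴴ * V') i j) * p' i = 0)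
    (htr : ∑ i, ∑ j, Complex.normSq ((U'ᴴ * V') i j) * p' i =
      ∑ i, ∑ j, Complex.normSq ((Uᴴ * V) i j) * p i)
    (hY : ∀ X : Matrix m m ℂ, ∃ Y : Matrix n n ℂ, (ρ * Y).trace = (ρ' * X).trace ∧
      (ρ * (Yᴴ * Y)).trace = (ρ' * (Xᴴ * X)).trace ∧
      (σ * (Y * Yᴴ)).trace = (σ' * (X * Xᴴ)).trace) :
    ∑ i, ∑ j, Complex.normSq ((U'ᴴ * V') i j) * p' i * (Real.log (p' i) - Real.log (q' j)) ≤
      ∑ i, ∑ j, Complex.normSq ((Uᴴ * V) i j) * p i * (Real.log (p i) - Real.log (q j)) := by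
  have key : ∀ {s : ℝ}, 0 < s → s < 1 →
      ∑ i, ∑ j, Complex.normSq ((U'ᴴ * V') i j) * p' i ^ 2 / (s * q' j + (1 - s) * p' i) ≤
      ∑ i, ∑ j, Complex.normSq ((Uᴴ * V) i j) * p i ^ 2 / (s * q j + (1 - s) * p i) := by
    intro s hs hs1
    -- The optimal $X$ for the primed pair lifts to a $Y$ with the same value of the functional,
    -- which is at most the maximum for the unprimed pair.
    obtain ⟨X, hX⟩ := exists_re_trace_mul_functional_eq hU' hV' hρ' hσ' s
    obtain ⟨Y, h1, h2, h3⟩ := hY X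
    rw [← hX, ← h1, ← h2, ← h3]
    exact re_trace_mul_functional_le hU hV hρ hσ hp hq hs hs1 Y
  -- Equal masses (`htr`) cancel in the derivative, leaving the difference in `key` divided by $s$.
  -- From $s=0$ to $s=1$ the function increases by the unprimed relative entropy minus the primed
  -- one.
  have mono : MonotoneOn (fun s : ℝ =>
      (∑ i, ∑ j, Complex.normSq ((U'ᴴ * V') i j) * p' i * Real.log (s * q' j + (1 - s) * p' i)) -
      ∑ i, ∑ j, Complex.normSq ((Uᴴ * V) i j) * p i * Real.log (s * q j + (1 - s) * p i))
      (Set.Icc 0 1) := by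
    refine monotoneOn_of_hasDerivWithinAt_nonneg (convex_Icc 0 1)
      ((continuousOn_sum_mul_log_interpolate _ p' q' hp' hq' hpq').sub
        (continuousOn_sum_mul_log_interpolate _ p q hp hq hpq))
      (fun s hs => ((hasDerivAt_sum_mul_log_interpolate _ p' q' hp' hq' (by simpa using hs)).sub
        (hasDerivAt_sum_mul_log_interpolate _ p q hp hq (by simpa using hs))).hasDerivWithinAt)
      fun s hs => ?_
    rw [interior_Icc] at hs
    rw [htr, ← sub_div]
    exact div_nonneg (by linarith [key hs.1 hs.2]) hs.1.le
  have := mono (Set.left_mem_Icc.mpr zero_le_one) (Set.right_mem_Icc.mpr zero_le_one) zero_le_one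
  simp only [zero_mul, sub_zero, one_mul, zero_add, sub_self, add_zero] at this
  simp only [mul_sub, Finset.sum_sub_distrib]
  linarith

end Matrix

/-! ### Partial trace by duality, and unitary overlaps -/

namespace Matrix

theorem trace_mul_kronecker_one {m n : Type*} [Fintype m] [Fintype n] [DecidableEq n]
    (M : Matrix (m × n) (m × n) ℂ) (X : Matrix m m ℂ) :
    (M * (X ⊗ₖ (1 : Matrix n n ℂ))).trace =
      (Matrix.of (fun x x' => ∑ y, M (x, y) (x', y)) * X).trace := by
  simp only [Matrix.trace, Matrix.diag_apply, Matrix.mul_apply, Fintype.sum_prod_type,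
    Matrix.kroneckerMap_apply, Matrix.one_apply, Matrix.of_apply, mul_ite, mul_one, mul_zero,
    Finset.sum_ite_eq', Finset.mem_univ, if_true, Finset.sum_mul]
  exact Finset.sum_congr rfl fun i _ => Finset.sum_comm

theorem trace_mul_submatrix_equiv {m n : Type*} [Fintype m] [Fintype n] (e : m ≃ n)
    (M : Matrix m m ℂ) (X : Matrix n n ℂ) :
    (M * X.submatrix e e).trace = (M.submatrix e.symm e.symm * X).trace := by
  have h : M * X.submatrix e e = (M.submatrix e.symm e.symm * X).submatrix e e := by
    rw [← Matrix.submatrix_mul_equiv _ _ _ e]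
    simp
  rw [h]
  exact Equiv.sum_comp e fun i => (M.submatrix e.symm e.symm * X) i i

theorem sum_normSq_conjTranspose_mul_eq_one {n : Type*} [Fintype n] [DecidableEq n]
    {U V : Matrix n n ℂ} (hU : U * Uᴴ = 1) (hV : V * Vᴴ = 1) (i : n) :
    ∑ j, Complex.normSq ((Uᴴ * V) i j) = 1 := by
  have h : (Uᴴ * V) * (Uᴴ * V)ᴴ = 1 := by
    rw [Matrix.conjTranspose_mul, Matrix.conjTranspose_conjTranspose, Matrix.mul_assoc,
      ← Matrix.mul_assoc V, hV, Matrix.one_mul, mul_eq_one_comm.mp hU]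
  have h2 := congrFun (congrFun h i) i
  rw [Matrix.mul_apply, Matrix.one_apply_eq] at h2
  simp only [Matrix.conjTranspose_apply, Complex.star_def, Complex.mul_conj] at h2
  exact_mod_cast h2

theorem sum_normSq_conjTranspose_mul_mul {n : Type*} [Fintype n] [DecidableEq n]
    {U ρ : Matrix n n ℂ} {p : n → ℝ} (hρ : ρ = U * diagonal (fun i => (p i : ℂ)) * Uᴴ)
    (V : Matrix n n ℂ) (j : n) :
    ((∑ i, Complex.normSq ((Uᴴ * V) i j) * p i : ℝ) : ℂ) = (Vᴴ * ρ * V) j j := by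
  have h : Vᴴ * ρ * V = (Uᴴ * V)ᴴ * (diagonal (fun i => (p i : ℂ)) * (Uᴴ * V)) := by
    rw [hρ, Matrix.conjTranspose_mul, Matrix.conjTranspose_conjTranspose]
    simp only [Matrix.mul_assoc]
  rw [h, Matrix.mul_apply]
  push_cast
  refine Finset.sum_congr rfl fun i _ => ?_
  rw [Matrix.diagonal_mul, Matrix.conjTranspose_apply, Complex.normSq_eq_conj_mul_self,
    Complex.star_def]
  ring

end Matrix

/-! ### Entropy from an arbitrary diagonalisation -/

namespace QState

open Matrix

theorem exists_spectral {X : Type*} [Fintype X] [DecidableEq X] (ρ : QState X) :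
    ∃ (U : Matrix X X ℂ) (p : X → ℝ), U * Uᴴ = 1 ∧ (∀ i, 0 ≤ p i) ∧
      ρ.matrix = U * diagonal (fun i => (p i : ℂ)) * Uᴴ := by
  refine ⟨ρ.posSemidef.isHermitian.eigenvectorUnitary, ρ.posSemidef.isHermitian.eigenvalues, ?_,
    ρ.posSemidef.eigenvalues_nonneg, ?_⟩
  · exact Unitary.coe_mul_star_self _
  · conv_lhs => rw [ρ.posSemidef.isHermitian.spectral_theorem]
    rfl

theorem sum_eq_one_of_spectral {X : Type*} [Fintype X] [DecidableEq X] {ρ : QState X}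
    {U : Matrix X X ℂ} {p : X → ℝ} (hU : U * Uᴴ = 1)
    (hρ : ρ.matrix = U * diagonal (fun i => (p i : ℂ)) * Uᴴ) : ∑ i, p i = 1 := by
  have h := ρ.trace_one
  rw [hρ, Matrix.trace_mul_comm, ← Matrix.mul_assoc, mul_eq_one_comm.mp hU, Matrix.one_mul,
    Matrix.trace_diagonal] at h
  exact_mod_cast h

/-- The characteristic polynomial depends neither on an eigenbasis nor on the labelling, so entropy
can be read off any unitary diagonalisation and is invariant under relabelling. -/
theorem entropy_eq_sum_roots {X : Type*} [Fintype X] [DecidableEq X] (ρ : QState X) :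
    ρ.entropy = (ρ.matrix.charpoly.roots.map fun z => Real.negMulLog z.re).sum := by
  rw [ρ.posSemidef.isHermitian.roots_charpoly_eq_eigenvalues, Multiset.map_map]
  simp [entropy]

theorem entropy_eq_of_spectral {X : Type*} [Fintype X] [DecidableEq X] {ρ : QState X}
    {U : Matrix X X ℂ} {p : X → ℝ} (hU : U * Uᴴ = 1)
    (hρ : ρ.matrix = U * diagonal (fun i => (p i : ℂ)) * Uᴴ) :
    ρ.entropy = ∑ i, Real.negMulLog (p i) := by
  have h : ρ.matrix.charpoly = ∏ i, (Polynomial.X - Polynomial.C (p i : ℂ)) := by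
    rw [hρ, Matrix.charpoly_mul_comm, ← Matrix.mul_assoc, mul_eq_one_comm.mp hU, Matrix.one_mul,
      Matrix.charpoly_diagonal]
  rw [entropy_eq_sum_roots, h, Polynomial.roots_prod]
  · simp
  · simp [Finset.prod_ne_zero_iff, Polynomial.X_sub_C_ne_zero]

theorem entropy_reindex {X Y : Type*} [Fintype X] [DecidableEq X] [Fintype Y] [DecidableEq Y]
    (e : X ≃ Y) (ρ : QState X) : (ρ.reindex e).entropy = ρ.entropy := by
  rw [entropy_eq_sum_roots, entropy_eq_sum_roots]
  congr 3
  exact Matrix.charpoly_reindex e ρ.matrix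

/-! ### Relative entropy of a state to $1\otimes\rho_Y$ -/

section Conditional

variable {A Y : Type*} [Fintype A] [DecidableEq A] [Fintype Y]

theorem sum_conj_one_kronecker_apply (ρ : QState (A × Y)) (W : Matrix Y Y ℂ) (k : Y) :
    ∑ a, (((1 : Matrix A A ℂ) ⊗ₖ W)ᴴ * ρ.matrix * ((1 : Matrix A A ℂ) ⊗ₖ W)) (a, k) (a, k) =
      (Wᴴ * ρ.traceLeft.matrix * W) k k := by
  simp only [Matrix.mul_apply, Fintype.sum_prod_type, Matrix.kroneckerMap_apply,
    Matrix.conjTranspose_apply, Matrix.one_apply, traceLeft, traceRight, reindex,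
    Matrix.of_apply, Matrix.submatrix_apply, ite_mul, one_mul, zero_mul, mul_ite, mul_zero,
    apply_ite star, star_zero, Finset.sum_ite_irrel, Finset.sum_const_zero,
    Finset.sum_ite_eq', Finset.mem_univ, if_true]
  simp only [Equiv.prodComm_symm, Equiv.prodComm_apply, Prod.swap_prod_mk, Finset.sum_mul,
    Finset.mul_sum]
  rw [Finset.sum_comm]
  refine Finset.sum_congr rfl fun y _ => ?_
  rw [Finset.sum_comm]

variable [DecidableEq Y] {ρ : QState (A × Y)} {U : Matrix (A × Y) (A × Y) ℂ} {p : A × Y → ℝ}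
  {W : Matrix Y Y ℂ} {q : Y → ℝ}

theorem sum_sum_normSq_one_kronecker
    (hρ : ρ.matrix = U * diagonal (fun i => (p i : ℂ)) * Uᴴ) (hW : W * Wᴴ = 1)
    (hσ : ρ.traceLeft.matrix = W * diagonal (fun i => (q i : ℂ)) * Wᴴ) (k : Y) :
    ∑ a, ∑ i, Complex.normSq ((Uᴴ * ((1 : Matrix A A ℂ) ⊗ₖ W)) i (a, k)) * p i = q k := by
  have h := sum_conj_one_kronecker_apply ρ W k
  rw [hσ, show Wᴴ * (W * diagonal (fun i => (q i : ℂ)) * Wᴴ) * W =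
    (Wᴴ * W) * diagonal (fun i => (q i : ℂ)) * (Wᴴ * W) by simp only [Matrix.mul_assoc],
    mul_eq_one_comm.mp hW, Matrix.one_mul, Matrix.mul_one, Matrix.diagonal_apply_eq] at h
  simp only [← Matrix.sum_normSq_conjTranspose_mul_mul hρ] at h
  exact_mod_cast h

/-- The support of $\rho$ lies in that of $1\otimes\rho_Y$: these nonnegative weights are summands
of the eigenvalue $q_k$, which is zero. -/
theorem normSq_one_kronecker_mul_eq_zero (hp : ∀ i, 0 ≤ p i)
    (hρ : ρ.matrix = U * diagonal (fun i => (p i : ℂ)) * Uᴴ) (hW : W * Wᴴ = 1)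
    (hσ : ρ.traceLeft.matrix = W * diagonal (fun i => (q i : ℂ)) * Wᴴ) (i j : A × Y)
    (hj : q j.2 = 0) :
    Complex.normSq ((Uᴴ * ((1 : Matrix A A ℂ) ⊗ₖ W)) i j) * p i = 0 := by
  have h := sum_sum_normSq_one_kronecker hρ hW hσ j.2
  have hn : ∀ a i, 0 ≤ Complex.normSq ((Uᴴ * ((1 : Matrix A A ℂ) ⊗ₖ W)) i (a, j.2)) * p i :=
    fun a i => mul_nonneg (Complex.normSq_nonneg _) (hp i)
  rw [hj, Finset.sum_eq_zero_iff_of_nonneg fun a _ => Finset.sum_nonneg fun i _ => hn a i] at h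
  have h2 := h j.1 (Finset.mem_univ _)
  rw [Finset.sum_eq_zero_iff_of_nonneg fun i _ => hn j.1 i] at h2
  exact h2 i (Finset.mem_univ _)

theorem one_kronecker_mul_conjTranspose (hW : W * Wᴴ = 1) :
    ((1 : Matrix A A ℂ) ⊗ₖ W) * ((1 : Matrix A A ℂ) ⊗ₖ W)ᴴ = 1 := by
  rw [Matrix.conjTranspose_kronecker, ← Matrix.mul_kronecker_mul, hW, Matrix.conjTranspose_one,
    Matrix.mul_one, Matrix.one_kronecker_one]

/-- The weights $|\langle u_i|a,w_k\rangle|^2p_i$ have marginal $p$ in $i$ and, once $a$ is summed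
out, marginal $q$ in $k$. -/
theorem sum_normSq_one_kronecker_mul_log (hU : U * Uᴴ = 1)
    (hρ : ρ.matrix = U * diagonal (fun i => (p i : ℂ)) * Uᴴ) (hW : W * Wᴴ = 1)
    (hσ : ρ.traceLeft.matrix = W * diagonal (fun i => (q i : ℂ)) * Wᴴ) :
    ∑ i, ∑ j : A × Y, Complex.normSq ((Uᴴ * ((1 : Matrix A A ℂ) ⊗ₖ W)) i j) * p i *
      (Real.log (p i) - Real.log (q j.2)) = ρ.traceLeft.entropy - ρ.entropy := by
  rw [entropy_eq_of_spectral hU hρ, entropy_eq_of_spectral hW hσ]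
  simp only [mul_sub, Finset.sum_sub_distrib]
  have h1 : ∑ i, ∑ j : A × Y, Complex.normSq ((Uᴴ * ((1 : Matrix A A ℂ) ⊗ₖ W)) i j) * p i *
      Real.log (p i) = - ∑ i, Real.negMulLog (p i) := by
    rw [← Finset.sum_neg_distrib]
    refine Finset.sum_congr rfl fun i _ => ?_
    rw [← Finset.sum_mul, ← Finset.sum_mul,
      Matrix.sum_normSq_conjTranspose_mul_eq_one hU (one_kronecker_mul_conjTranspose hW)]
    simp [Real.negMulLog]
  have h2 : ∑ i, ∑ j : A × Y, Complex.normSq ((Uᴴ * ((1 : Matrix A A ℂ) ⊗ₖ W)) i j) * p i *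
      Real.log (q j.2) = - ∑ k, Real.negMulLog (q k) := by
    rw [← Finset.sum_neg_distrib, Finset.sum_comm, Fintype.sum_prod_type, Finset.sum_comm]
    refine Finset.sum_congr rfl fun k _ => ?_
    simp only [← Finset.sum_mul]
    rw [sum_sum_normSq_one_kronecker hρ hW hσ]
    simp [Real.negMulLog]
  rw [h1, h2]
  ring

theorem sum_normSq_one_kronecker_mul (hU : U * Uᴴ = 1)
    (hρ : ρ.matrix = U * diagonal (fun i => (p i : ℂ)) * Uᴴ) (hW : W * Wᴴ = 1) :
    ∑ i, ∑ j, Complex.normSq ((Uᴴ * ((1 : Matrix A A ℂ) ⊗ₖ W)) i j) * p i = 1 := by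
  rw [← sum_eq_one_of_spectral hU hρ]
  refine Finset.sum_congr rfl fun i _ => ?_
  rw [← Finset.sum_mul,
    Matrix.sum_normSq_conjTranspose_mul_eq_one hU (one_kronecker_mul_conjTranspose hW), one_mul]

theorem one_kronecker_spectral {σ : Matrix Y Y ℂ}
    (hσ : σ = W * diagonal (fun i => (q i : ℂ)) * Wᴴ) :
    (1 : Matrix A A ℂ) ⊗ₖ σ = ((1 : Matrix A A ℂ) ⊗ₖ W) *
      diagonal (fun j : A × Y => (q j.2 : ℂ)) * ((1 : Matrix A A ℂ) ⊗ₖ W)ᴴ := by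
  have h : diagonal (fun j : A × Y => (q j.2 : ℂ)) =
      (1 : Matrix A A ℂ) ⊗ₖ diagonal (fun k => (q k : ℂ)) := by
    rw [← Matrix.diagonal_one, Matrix.diagonal_kronecker_diagonal]
    simp
  rw [h, Matrix.conjTranspose_kronecker, ← Matrix.mul_kronecker_mul, ← Matrix.mul_kronecker_mul,
    hσ, Matrix.conjTranspose_one, Matrix.mul_one, Matrix.mul_one]

end Conditional

/-! ### Strong subadditivity -/

section Tripartite

variable {A B C : Type*} [Fintype A] [Fintype B] [Fintype C]

theorem traceRight_marginalAB (ρ : QState (A × B × C)) :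
    ρ.marginalAB.traceRight = ρ.traceRight := by
  ext a a'
  simp [marginalAB, traceRight, reindex, Fintype.sum_prod_type]

variable [DecidableEq C]

theorem trace_mul_kronecker_one_submatrix (ρ : QState (A × B × C)) (K : Matrix (A × B) (A × B) ℂ) :
    (ρ.matrix * (K ⊗ₖ (1 : Matrix C C ℂ)).submatrix (Equiv.prodAssoc A B C).symm
      (Equiv.prodAssoc A B C).symm).trace = (ρ.marginalAB.matrix * K).trace := by
  rw [Matrix.trace_mul_submatrix_equiv, Matrix.trace_mul_kronecker_one]
  rfl

variable [DecidableEq A]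

theorem trace_one_kronecker_mul_kronecker_one_submatrix (ρ : QState (A × B × C))
    (K : Matrix (A × B) (A × B) ℂ) :
    (((1 : Matrix A A ℂ) ⊗ₖ ρ.traceLeft.matrix) *
      (K ⊗ₖ (1 : Matrix C C ℂ)).submatrix (Equiv.prodAssoc A B C).symm
      (Equiv.prodAssoc A B C).symm).trace =
    (((1 : Matrix A A ℂ) ⊗ₖ ρ.marginalAB.traceLeft.matrix) * K).trace := by
  rw [Matrix.trace_mul_submatrix_equiv, Matrix.trace_mul_kronecker_one]
  congr 2
  ext ⟨a, b⟩ ⟨a', b'⟩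
  simp only [Matrix.of_apply, Matrix.submatrix_apply, Matrix.kroneckerMap_apply, traceLeft,
    marginalAB, traceRight, reindex, Equiv.symm_symm, Equiv.prodAssoc_apply,
    Equiv.prodComm_symm, Equiv.prodComm_apply, Prod.swap_prod_mk]
  rw [Finset.sum_comm]
  rw [Finset.mul_sum]

/-- The witness is $Y=X\otimes 1_C$. The map $X\mapsto X\otimes 1_C$ is multiplicative, commutes
with adjoints and is dual to tracing out $C$, which sends $1\otimes\rho_{BC}$ to $1\otimes\rho_B$.
-/
theorem exists_trace_mul_eq_marginalAB (ρ : QState (A × B × C)) (X : Matrix (A × B) (A × B) ℂ) :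
    ∃ Y : Matrix (A × B × C) (A × B × C) ℂ,
      (ρ.matrix * Y).trace = (ρ.marginalAB.matrix * X).trace ∧
      (ρ.matrix * (Yᴴ * Y)).trace = (ρ.marginalAB.matrix * (Xᴴ * X)).trace ∧
      (((1 : Matrix A A ℂ) ⊗ₖ ρ.traceLeft.matrix) * (Y * Yᴴ)).trace =
        (((1 : Matrix A A ℂ) ⊗ₖ ρ.marginalAB.traceLeft.matrix) * (X * Xᴴ)).trace := by
  refine ⟨(X ⊗ₖ (1 : Matrix C C ℂ)).submatrix (Equiv.prodAssoc A B C).symm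
    (Equiv.prodAssoc A B C).symm, trace_mul_kronecker_one_submatrix ρ X, ?_, ?_⟩
  · rw [← trace_mul_kronecker_one_submatrix, Matrix.conjTranspose_submatrix,
      Matrix.submatrix_mul_equiv, Matrix.conjTranspose_kronecker, ← Matrix.mul_kronecker_mul,
      Matrix.conjTranspose_one, Matrix.mul_one]
  · rw [← trace_one_kronecker_mul_kronecker_one_submatrix, Matrix.conjTranspose_submatrix,
      Matrix.submatrix_mul_equiv, Matrix.conjTranspose_kronecker, ← Matrix.mul_kronecker_mul,
      Matrix.conjTranspose_one, Matrix.mul_one]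

variable [DecidableEq B]

/-- **Strong subadditivity** of the von Neumann entropy. -/
theorem entropy_strong_subadditivity (ρ : QState (A × B × C)) :
    ρ.marginalAB.traceLeft.entropy - ρ.marginalAB.entropy ≤
      ρ.traceLeft.entropy - ρ.entropy := by
  obtain ⟨U, p, hU, hp, hρ⟩ := ρ.exists_spectral
  obtain ⟨W, q, hW, hq, hσ⟩ := ρ.traceLeft.exists_spectral
  obtain ⟨U', p', hU', hp', hρ'⟩ := ρ.marginalAB.exists_spectral
  obtain ⟨W', q', hW', hq', hσ'⟩ := ρ.marginalAB.traceLeft.exists_spectral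
  have hV := one_kronecker_mul_conjTranspose (A := A) hW
  have hV' := one_kronecker_mul_conjTranspose (A := A) hW'
  have hS := one_kronecker_spectral (A := A) hσ
  have hS' := one_kronecker_spectral (A := A) hσ'
  have hs := normSq_one_kronecker_mul_eq_zero hp hρ hW hσ
  have hs' := normSq_one_kronecker_mul_eq_zero hp' hρ' hW' hσ'
  have hY := exists_trace_mul_eq_marginalAB ρ
  have htr := (sum_normSq_one_kronecker_mul hU' hρ' hW').trans
    (sum_normSq_one_kronecker_mul hU hρ hW).symm
  rw [← sum_normSq_one_kronecker_mul_log hU hρ hW hσ,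
    ← sum_normSq_one_kronecker_mul_log hU' hρ' hW' hσ']
  generalize (1 : Matrix A A ℂ) ⊗ₖ W = V at *
  generalize (1 : Matrix A A ℂ) ⊗ₖ W' = V' at *
  generalize (1 : Matrix A A ℂ) ⊗ₖ ρ.traceLeft.matrix = σ at *
  generalize (1 : Matrix A A ℂ) ⊗ₖ ρ.marginalAB.traceLeft.matrix = σ' at *
  exact Matrix.sum_normSq_mul_log_sub_log_le hU hV hρ hS hp (fun j => hq j.2) hs
    hU' hV' hρ' hS' hp' (fun j => hq' j.2) hs' htr hY

theorem qcmi_eq (ρ : QState (A × B × C)) :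
    ρ.qcmi = ρ.traceLeft.entropy + ρ.marginalAB.entropy - ρ.entropy -
      ρ.marginalAB.traceLeft.entropy := by
  rw [qcmi, mutualInfo, mutualInfo, traceRight_marginalAB]
  ring

theorem qcmi_nonneg (ρ : QState (A × B × C)) : 0 ≤ ρ.qcmi := by
  rw [qcmi_eq]
  linarith [ρ.entropy_strong_subadditivity]

end Tripartite

end QState

/-! ### Flagged ensembles -/

namespace QState

open Matrix

section Flag

variable {X E : Type*} [Fintype X] [Fintype E]

/-- `σ = ∑ i, p i • ρ i ⊗ |V i⟩⟨V i|`, where `V i` is the `i`-th column of `V`. -/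
def IsFlagged (σ : QState (X × E)) (p : E → ℝ) (ρ : E → QState X) (V : Matrix E E ℂ) : Prop :=
  ∀ x e x' e', σ.matrix (x, e) (x', e') =
    ∑ i, (p i : ℂ) * (ρ i).matrix x x' * (V e i * star (V e' i))

/-- Entropy of a flagged ensemble: the Shannon entropy of the flag plus the average entropy. -/
theorem IsFlagged.entropy_eq [DecidableEq X] [DecidableEq E] {σ : QState (X × E)} {p : E → ℝ}
    {ρ : E → QState X} {V : Matrix E E ℂ} (h : σ.IsFlagged p ρ V) (hV : V * Vᴴ = 1) :
    σ.entropy = ∑ i, Real.negMulLog (p i) + ∑ i, p i * (ρ i).entropy := by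
  choose U q hU _ hρ using fun i => (ρ i).exists_spectral
  -- The columns are $u^{(i)}_k\otimes v_i$, with $u^{(i)}_k$ an eigenvector of the $i$-th member;
  -- the eigenvalues are the products $p_iq^{(i)}_k$.
  let W : Matrix (X × E) (X × E) ℂ := Matrix.of fun x k => U k.2 x.1 k.1 * V x.2 k.2
  have hW : W * Wᴴ = 1 := by
    rw [mul_eq_one_comm]
    ext ⟨k, i⟩ ⟨l, j⟩
    have hV' : (Vᴴ * V) i j = (1 : Matrix E E ℂ) i j := by rw [mul_eq_one_comm.mp hV]
    have hU' : ((U i)ᴴ * U i) k l = (1 : Matrix X X ℂ) k l := by rw [mul_eq_one_comm.mp (hU i)]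
    rw [Matrix.mul_apply] at hV' hU'
    have h1 : (Wᴴ * W) (k, i) (l, j) =
        (∑ x, (U i)ᴴ k x * U j x l) * ∑ e, Vᴴ i e * V e j := by
      rw [Matrix.mul_apply, Fintype.sum_prod_type, Finset.sum_mul_sum]
      refine Finset.sum_congr rfl fun x _ => Finset.sum_congr rfl fun e _ => ?_
      simp only [W, Matrix.conjTranspose_apply, Matrix.of_apply, star_mul']
      ring
    rw [h1, hV']
    by_cases hij : i = j
    · subst hij
      rw [hU']
      simp [Matrix.one_apply]
    · simp [hij]
  have hσ : σ.matrix = W * diagonal (fun k : X × E => ((p k.2 * q k.2 k.1 : ℝ) : ℂ)) * Wᴴ := by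
    ext ⟨x, e⟩ ⟨x', e'⟩
    rw [h, Matrix.mul_apply, Fintype.sum_prod_type, Finset.sum_comm]
    refine Finset.sum_congr rfl fun i _ => ?_
    rw [hρ i, Matrix.mul_apply, Finset.mul_sum, Finset.sum_mul]
    refine Finset.sum_congr rfl fun k _ => ?_
    simp only [Matrix.mul_diagonal, W, Matrix.conjTranspose_apply, Matrix.of_apply, star_mul',
      Complex.ofReal_mul]
    ring
  rw [entropy_eq_of_spectral hW hσ, Fintype.sum_prod_type, Finset.sum_comm,
    ← Finset.sum_add_distrib]
  refine Finset.sum_congr rfl fun i _ => ?_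
  simp only [Real.negMulLog_mul, Finset.sum_add_distrib]
  rw [← Finset.sum_mul, ← Finset.mul_sum, sum_eq_one_of_spectral (hU i) (hρ i), one_mul,
    entropy_eq_of_spectral (hU i) (hρ i)]

variable {A B C D : Type*} [Fintype A] [DecidableEq A] [Fintype B] [DecidableEq B]
  [Fintype C] [DecidableEq C] [Fintype D] [DecidableEq E]

/-- All four marginals in the entropy formula keep $E$, hence are flagged with the same $p$ and $V$;
the flag entropy occurs twice with each sign and cancels. -/
theorem qcmi_eq_sum_of_flagged {τ : QState (A × (B × E) × C)} {p : E → ℝ}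
    {ρ : E → QState (A × B × C)} {V : Matrix E E ℂ} (hV : V * Vᴴ = 1)
    (h : ∀ a b e c a' b' e' c', τ.matrix (a, (b, e), c) (a', (b', e'), c') =
      ∑ i, (p i : ℂ) * (ρ i).matrix (a, b, c) (a', b', c') * (V e i * star (V e' i))) :
    τ.qcmi = ∑ i, p i * (ρ i).qcmi := by
  let e1 : A × (B × E) × C ≃ (A × B × C) × E :=
    { toFun := fun (a, (b, e), c) => ((a, b, c), e)
      invFun := fun ((a, b, c), e) => (a, (b, e), c)
      left_inv := fun _ => rfl
      right_inv := fun _ => rfl }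
  let e2 : (B × E) × C ≃ (B × C) × E :=
    { toFun := fun ((b, e), c) => ((b, c), e)
      invFun := fun ((b, c), e) => ((b, e), c)
      left_inv := fun _ => rfl
      right_inv := fun _ => rfl }
  have h1 : (τ.reindex e1).IsFlagged p ρ V := fun ⟨a, b, c⟩ e ⟨a', b', c'⟩ e' =>
    h a b e c a' b' e' c'
  have h2 : (τ.traceLeft.reindex e2).IsFlagged p (fun i => (ρ i).traceLeft) V := by
    rintro ⟨b, c⟩ e ⟨b', c'⟩ e'
    change ∑ a, τ.matrix (a, (b, e), c) (a, (b', e'), c') =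
      ∑ i, (p i : ℂ) * (∑ a, (ρ i).matrix (a, b, c) (a, b', c')) * _
    simp only [h, Finset.mul_sum, Finset.sum_mul]
    exact Finset.sum_comm
  have h3 : (τ.marginalAB.reindex (Equiv.prodAssoc A B E).symm).IsFlagged p
      (fun i => (ρ i).marginalAB) V := by
    rintro ⟨a, b⟩ e ⟨a', b'⟩ e'
    change ∑ c, τ.matrix (a, (b, e), c) (a', (b', e'), c) =
      ∑ i, (p i : ℂ) * (∑ c, (ρ i).matrix (a, b, c) (a', b', c)) * _
    simp only [h, Finset.mul_sum, Finset.sum_mul]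
    exact Finset.sum_comm
  have h4 : τ.marginalAB.traceLeft.IsFlagged p (fun i => (ρ i).marginalAB.traceLeft) V := by
    rintro b e b' e'
    change ∑ a, ∑ c, τ.matrix (a, (b, e), c) (a, (b', e'), c) =
      ∑ i, (p i : ℂ) * (∑ a, ∑ c, (ρ i).matrix (a, b, c) (a, b', c)) * _
    simp only [h, Finset.mul_sum, Finset.sum_mul]
    rw [Finset.sum_comm' (t' := Finset.univ) (s' := fun _ => Finset.univ) (by simp)]
    conv_rhs => rw [Finset.sum_comm]
    rw [Finset.sum_comm]
    exact Finset.sum_congr rfl fun a _ => Finset.sum_comm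
  rw [qcmi_eq, ← entropy_reindex e1 τ, ← entropy_reindex e2 τ.traceLeft,
    ← entropy_reindex (Equiv.prodAssoc A B E).symm τ.marginalAB, h1.entropy_eq hV,
    h2.entropy_eq hV, h3.entropy_eq hV, h4.entropy_eq hV]
  simp only [qcmi_eq, mul_sub, mul_add, Finset.sum_add_distrib, Finset.sum_sub_distrib]
  ring

theorem IsFlagged.qcmi_marginalABEC {σ : QState ((A × B × C × D) × E)} {p : E → ℝ}
    {ρ : E → QState (A × B × C × D)} {V : Matrix E E ℂ} (h : σ.IsFlagged p ρ V)
    (hV : V * Vᴴ = 1) :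
    σ.marginalABEC.qcmi = ∑ i, p i * (ρ i).marginalABC.qcmi := by
  refine qcmi_eq_sum_of_flagged hV fun a b e c a' b' e' c' => ?_
  change ∑ d, σ.matrix ((a, b, c, d), e) ((a', b', c', d), e') =
      ∑ i, (p i : ℂ) * (∑ d, (ρ i).matrix (a, b, c, d) (a', b', c', d)) * _
  simp only [h _ e _ e', Finset.mul_sum, Finset.sum_mul]
  exact Finset.sum_comm

end Flag

/-! ### Extensions of pure states -/

section Pure

variable {X E : Type*} [Fintype X] [Fintype E]

open scoped MatrixOrder Matrix.Norms.L2Operator in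
/-- An extension of a pure state is a product state. -/
theorem matrix_eq_mul_of_isPure_traceRight (σ : QState (X × E)) (h : σ.traceRight.IsPure)
    (x : X) (e : E) (x' : X) (e' : E) :
    σ.matrix (x, e) (x', e') = σ.traceRight.matrix x x' * σ.traceLeft.matrix e e' := by
  classical
  obtain ⟨v, hv⟩ := h
  obtain ⟨R, hR⟩ := CStarAlgebra.nonneg_iff_eq_star_mul_self.mp σ.posSemidef.nonneg
  have hv1 : ∑ x, v x * star (v x) = 1 := by
    have := σ.traceRight.trace_one
    rw [hv] at this
    simpa [Matrix.trace, Matrix.vecMulVec_apply] using this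
  have hρ : ∀ x x', ∑ e, σ.matrix (x, e) (x', e) = v x * star (v x') := fun x x' => by
    have := congrFun (congrFun hv x) x'
    simpa [traceRight, Matrix.vecMulVec_apply] using this
  have hσ : ∀ x e x' e', σ.matrix (x, e) (x', e') =
      ∑ k, star (R k (x, e)) * R k (x', e') := fun x e x' e' => by
    rw [hR, Matrix.mul_apply]
    rfl
  -- For $w\perp v$ the number $\langle w|\rho|w\rangle=0$ is a sum of squared moduli of the entries
  -- of $R$ applied to $w$, so every one of them vanishes.
  have hzero : ∀ w : X → ℂ, ∑ x, star (v x) * w x = 0 →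
      ∀ k e, ∑ x, R k (x, e) * w x = 0 := by
    intro w hw
    have h1 : ∑ k, ∑ e, star (∑ x, R k (x, e) * w x) * (∑ x, R k (x, e) * w x) = 0 := by
      calc _ = ∑ k, ∑ e, ∑ x, ∑ x', star (w x) * (star (R k (x, e)) * R k (x', e)) * w x' := by
            refine Finset.sum_congr rfl fun k _ => Finset.sum_congr rfl fun e _ => ?_
            rw [star_sum, Finset.sum_mul_sum]
            refine Finset.sum_congr rfl fun x _ => Finset.sum_congr rfl fun x' _ => ?_
            rw [star_mul']
            ring
        _ = ∑ x, ∑ x', ∑ e, ∑ k, star (w x) * (star (R k (x, e)) * R k (x', e)) * w x' := by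
            rw [Finset.sum_comm]
            simp_rw [Finset.sum_comm (s := (Finset.univ : Finset (X × E)))]
            rw [Finset.sum_comm]
            refine Finset.sum_congr rfl fun x _ => ?_
            rw [Finset.sum_comm]
        _ = ∑ x, ∑ x', star (w x) * (v x * star (v x')) * w x' := by
            simp only [← hρ, hσ, Finset.mul_sum, Finset.sum_mul]
        _ = (∑ x, star (w x) * v x) * ∑ x', star (v x') * w x' := by
            rw [Finset.sum_mul_sum]
            refine Finset.sum_congr rfl fun x _ => Finset.sum_congr rfl fun x' _ => ?_
            ring
        _ = 0 := by rw [hw, mul_zero]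
    have hn : ∀ z : ℂ, 0 ≤ star z * z := star_mul_self_nonneg
    intro k e
    rw [Finset.sum_eq_zero_iff_of_nonneg fun k _ => Finset.sum_nonneg fun e _ => hn _] at h1
    have h2 := h1 k (Finset.mem_univ _)
    rw [Finset.sum_eq_zero_iff_of_nonneg fun e _ => hn _] at h2
    have h3 := h2 e (Finset.mem_univ _)
    exact (mul_eq_zero.mp h3).elim star_eq_zero.mp id
  have hRv : ∀ k x e, R k (x, e) = star (v x) * ∑ y, R k (y, e) * v y := by
    intro k x e
    -- The component of the basis vector at $x$ orthogonal to the unit vector $v$.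
    have h1 := hzero (fun y => (if y = x then 1 else 0) - v y * star (v x)) (by
      simp only [mul_sub, Finset.sum_sub_distrib, ← mul_assoc, ← Finset.sum_mul]
      simp only [mul_comm (star (v _)) (v _), hv1]
      simp) k e
    simp only [mul_sub, Finset.sum_sub_distrib, ← mul_assoc, ← Finset.sum_mul] at h1
    simp only [mul_ite, mul_one, mul_zero, Finset.sum_ite_eq', Finset.mem_univ, if_true] at h1
    rw [mul_comm]
    exact sub_eq_zero.mp h1
  have hprod : ∀ x e x' e', σ.matrix (x, e) (x', e') = v x * star (v x') *
      ∑ k, star (∑ y, R k (y, e) * v y) * ∑ y, R k (y, e') * v y := by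
    intro x e x' e'
    rw [hσ, Finset.mul_sum]
    refine Finset.sum_congr rfl fun k _ => ?_
    rw [hRv k x e, hRv k x' e', star_mul', star_star]
    ring
  have hτ : σ.traceLeft.matrix e e' =
      ∑ k, star (∑ y, R k (y, e) * v y) * ∑ y, R k (y, e') * v y := by
    change ∑ x, σ.matrix (x, e) (x, e') = _
    simp only [hprod]
    rw [← Finset.sum_mul, hv1, one_mul]
  rw [hτ, hv, hprod, Matrix.vecMulVec_apply]
  rfl

/-- Diagonalising the $E$ factor of the product state turns it into a flagged ensemble whose members
all equal the pure state, so the entropy count for flags applies. -/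
theorem exists_isFlagged_of_isPure_traceRight [DecidableEq E] (σ : QState (X × E))
    (h : σ.traceRight.IsPure) : ∃ (p : E → ℝ) (V : Matrix E E ℂ), V * Vᴴ = 1 ∧
      ∑ i, p i = 1 ∧ σ.IsFlagged p (fun _ => σ.traceRight) V := by
  obtain ⟨V, p, hV, _, hτ⟩ := σ.traceLeft.exists_spectral
  refine ⟨p, V, hV, sum_eq_one_of_spectral hV hτ, fun x e x' e' => ?_⟩
  rw [matrix_eq_mul_of_isPure_traceRight σ h, hτ, Matrix.mul_apply, Finset.mul_sum]
  refine Finset.sum_congr rfl fun i _ => ?_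
  rw [Matrix.mul_diagonal, Matrix.conjTranspose_apply]
  ring

end Pure

/-! ### Pure-state ensembles and the two value sets -/

section Ensemble

variable {X : Type*} [Fintype X] {ρ : QState X}

/-- The spectral decomposition is such an ensemble: eigenvalues as probabilities, columns of $U$ as
pure states. -/
theorem nonempty_pureEnsemble (ρ : QState X) : Nonempty (PureEnsemble ρ) := by
  classical
  obtain ⟨U, p, hU, hp, hρ⟩ := ρ.exists_spectral
  let f := (Fintype.equivFin X).symm
  exact ⟨{
    size := Fintype.card X
    p := fun i => p (f i)
    ψ := fun i =>
      { matrix := vecMulVec (fun x => U x (f i)) (star fun x => U x (f i))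
        posSemidef := posSemidef_vecMulVec_self_star _
        trace_one := by
          have : (Uᴴ * U) (f i) (f i) = (1 : Matrix X X ℂ) (f i) (f i) := by
            rw [mul_eq_one_comm.mp hU]
          rw [Matrix.mul_apply, Matrix.one_apply_eq] at this
          rw [← this]
          exact Finset.sum_congr rfl fun x _ => mul_comm _ _ }
    p_nonneg := fun i => hp _
    p_sum := by rw [Equiv.sum_comp f p, sum_eq_one_of_spectral hU hρ]
    ψ_pure := fun i => ⟨_, rfl⟩
    average := by
      rw [Equiv.sum_comp f fun i =>
        (p i : ℂ) • vecMulVec (fun x => U x i) (star fun x => U x i), hρ]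
      ext x x'
      rw [Matrix.sum_apply, Matrix.mul_apply]
      refine Finset.sum_congr rfl fun i _ => ?_
      rw [Matrix.mul_diagonal, Matrix.conjTranspose_apply, Matrix.smul_apply,
        Matrix.vecMulVec_apply, smul_eq_mul, Pi.star_apply]
      ring }⟩

/-- Written so as to match `IsFlagged` with $V=1$. -/
theorem PureEnsemble.flagMatrix_apply (e : PureEnsemble ρ) (x : X) (i : Fin e.size) (x' : X)
    (i' : Fin e.size) : e.flagMatrix (x, i) (x', i') = ∑ k, (e.p k : ℂ) * (e.ψ k).matrix x x' *
      ((1 : Matrix (Fin e.size) (Fin e.size) ℂ) i k *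
        star ((1 : Matrix (Fin e.size) (Fin e.size) ℂ) i' k)) := by
  rw [PureEnsemble.flagMatrix, Matrix.sum_apply]
  refine Finset.sum_congr rfl fun k _ => ?_
  rw [Matrix.smul_apply, Matrix.kroneckerMap_apply, smul_eq_mul, Matrix.single_apply,
    Matrix.one_apply, Matrix.one_apply, mul_assoc]
  by_cases h1 : i = k <;> by_cases h2 : i' = k <;> simp [h1, h2, eq_comm]

theorem PureEnsemble.sum_flagMatrix_apply (e : PureEnsemble ρ) (x x' : X) :
    ∑ i, e.flagMatrix (x, i) (x', i) = ρ.matrix x x' := by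
  rw [← e.average, Matrix.sum_apply]
  simp only [e.flagMatrix_apply, Matrix.one_apply]
  refine Finset.sum_congr rfl fun k _ => ?_
  simp

/-- The flag extension `∑ i, p i • ψ i ⊗ |i⟩⟨i|` of the average state of an ensemble. -/
def PureEnsemble.flagState (e : PureEnsemble ρ) : QState (X × Fin e.size) where
  matrix := e.flagMatrix
  posSemidef := by
    refine Matrix.posSemidef_sum _ fun i _ => PosSemidef.smul ?_ ?_
    · refine (e.ψ i).posSemidef.kronecker ?_
      rw [← Matrix.diagonal_single]
      refine Matrix.PosSemidef.diagonal (Pi.single_nonneg.mpr zero_le_one)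
    · exact_mod_cast e.p_nonneg i
  trace_one := by
    rw [← ρ.trace_one, Matrix.trace, Fintype.sum_prod_type]
    exact Finset.sum_congr rfl fun x _ => e.sum_flagMatrix_apply x x

theorem PureEnsemble.traceRight_flagState (e : PureEnsemble ρ) : e.flagState.traceRight = ρ := by
  ext x x'
  exact e.sum_flagMatrix_apply x x'

variable {A B C D : Type*} [Fintype A] [DecidableEq A] [Fintype B] [DecidableEq B]
  [Fintype C] [DecidableEq C] [Fintype D]

theorem PureEnsemble.qcmi_flagState {ρ : QState (A × B × C × D)} (e : PureEnsemble ρ) :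
    e.flagState.marginalABEC.qcmi = e.averageQCMI :=
  IsFlagged.qcmi_marginalABEC (V := 1) e.flagMatrix_apply (by simp)

theorem ensembleValues_nonempty (ρ : QState (A × B × C × D)) : ρ.ensembleValues.Nonempty :=
  have := nonempty_pureEnsemble ρ
  Set.range_nonempty _

theorem ensembleValues_subset_extensionValues (ρ : QState (A × B × C × D)) :
    ρ.ensembleValues ⊆ ρ.extensionValues := by
  rintro _ ⟨e, rfl⟩
  exact ⟨e.size, e.flagState, e.traceRight_flagState, e.qcmi_flagState.symm⟩

theorem zero_mem_lowerBounds_extensionValues (ρ : QState (A × B × C × D)) :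
    0 ∈ lowerBounds ρ.extensionValues := by
  rintro _ ⟨n, σ, _, rfl⟩
  exact qcmi_nonneg _

theorem extensionValues_subset_of_isPure {ρ : QState (A × B × C × D)} (h : ρ.IsPure) :
    ρ.extensionValues ⊆ {ρ.marginalABC.qcmi} := by
  rintro _ ⟨n, σ, rfl, rfl⟩
  obtain ⟨p, V, hV, hp, hσ⟩ := σ.exists_isFlagged_of_isPure_traceRight h
  rw [Set.mem_singleton_iff, hσ.qcmi_marginalABEC hV, ← Finset.sum_mul, hp, one_mul]

end Ensemble

end QState

/-- The first two lines of the conclusion say that the infima that define `T_sq` and `co(QCMI)`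
are genuine infima of nonempty sets of reals that are bounded below. -/
theorem theorem1 {A B C D : Type*} [Fintype A] [DecidableEq A] [Fintype B] [DecidableEq B]
    [Fintype C] [DecidableEq C] [Fintype D] (ρ : QState (A × B × C × D)) :
    (ρ.extensionValues.Nonempty ∧ BddBelow ρ.extensionValues) ∧
    (ρ.ensembleValues.Nonempty ∧ BddBelow ρ.ensembleValues) ∧
    (0 ≤ ρ.hystereticSquashed ∧ ρ.hystereticSquashed ≤ ρ.coQCMI) ∧
    (∀ e : QState.PureEnsemble ρ, ∃ σ : QState ((A × B × C × D) × Fin e.size),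
      σ.matrix = e.flagMatrix ∧ σ.traceRight = ρ ∧ σ.marginalABEC.qcmi = e.averageQCMI) ∧
    (ρ.IsPure → ρ.hystereticSquashed = ρ.coQCMI ∧
      ρ.coQCMI = (1 / 2) * ρ.marginalABC.qcmi) := by
  have hsub := ρ.ensembleValues_subset_extensionValues
  have hne := ρ.ensembleValues_nonempty
  have hlb := ρ.zero_mem_lowerBounds_extensionValues
  refine ⟨⟨hne.mono hsub, 0, hlb⟩, ⟨hne, 0, fun x hx => hlb (hsub hx)⟩, ⟨?_, ?_⟩,
    fun e => ⟨e.flagState, rfl, e.traceRight_flagState, e.qcmi_flagState⟩, fun h => ?_⟩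
  · exact mul_nonneg (by norm_num) (le_csInf (hne.mono hsub) hlb)
  · exact mul_le_mul_of_nonneg_left (csInf_le_csInf ⟨0, hlb⟩ hne hsub) (by norm_num)
  · have hext := QState.extensionValues_subset_of_isPure h
    -- Both value sets are nonempty subsets of the same singleton, so each equals it.
    have h1 := (Set.Nonempty.subset_singleton_iff hne).mp (hsub.trans hext)
    have h2 := (Set.Nonempty.subset_singleton_iff (hne.mono hsub)).mp hext
    simp only [QState.hystereticSquashed, QState.coQCMI, h1, h2, csInf_singleton, and_self]
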